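/- Let $K_0$ be a number field and let $\Sigma=(G,K_0,\sigma)$ consist of $K_0$, a transitive permutation group $G$ of degree $n_0\ge 2$, and a signature $\sigma$ (for each infinite place of $K_0$, the number of real and of complex places above it). Let $\mathcal K(\Sigma)$ be the set of degree $n_0$ extensions $K/K_0$ inside a fixed algebraic closure of $\mathbb Q$ with signature $\sigma$ such that the Galois group of the Galois closure, acting on the embeddings of $K$, is permutation isomorphic to $G$. Let $\mathrm{Cl}(K/K_0)$ be the kernel of the norm map $\mathrm{Cl}_K\to\mathrm{Cl}_{K_0}$. The probability of a property of $K\in\mathcal K(\Sigma)$ is the limit, as $X\to\infty$, of the proportion of fields with that property among all $K\in\mathcal K(\Sigma)$ with $|d_K|\le X$. Let $K_1\in\mathcal K(\Sigma)$ have Galois closure $L$ over $K_0$, let $\chi_1=\chi-1$ where $\chi$ is the permutation character of $\mathrm{Gal}(L/K_0)$ on the embeddings of $K_1$ into $L$, let $\chi_E$ be the character of $\mathrm{Gal}(L/K_0)$ on $E_L\otimes_{\mathbb Z}\mathbb Q$ ($E_L$ the unit group of the ring of integers of $L$), and let $u=\langle\chi_E,\varphi\rangle$ for an absolutely irreducible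 constituent $\varphi$ of $\chi_1$. Let $p$ be a prime. For $q\ge 2$ write $(q)_k=\prod_{i=1}^k(1-q^{-i})$ and $(q)_\infty=\prod_{i=1}^\infty(1-q^{-i})$, and put $$c=\frac{(p^2)_u\,(p)_\infty}{(p)_u\,(p^2)_\infty}.$$ Assume that every finite abelian $p$-group $H$, of $p$-rank $r$ say, is isomorphic to the Sylow $p$-subgroup of $\mathrm{Cl}(K/K_0)$, $K\in\mathcal K(\Sigma)$, with probability $$\frac{c}{\prod_{i=1}^{u}(p^i-1)}\cdot\frac{\prod_{i=1}^{r+u}(p^i-1)}{p^{r(u+1)}}\cdot\frac{1}{|H|^u\,|\mathrm{Aut}(H)|}.$$ Then: 1. for every $r\ge 0$, the $p$-rank of $\mathrm{Cl}(K/K_0)$, $K\in\mathcal K(\Sigma)$, equals $r$ with probability $$\mathrm{pr}(r)=\frac{(p^2)_u\,(p)_\infty}{(p)_u\,(p^2)_\infty}\cdot\frac{1}{p^{r(r+2u+1)/2}\,(p)_r};$$ 2. for every $n\ge 0$, the $n$-th higher moment of this distribution is $$\sum_{r\ge 0}p^{nr}\,\mathrm{pr}(r)=\prod_{k=1}^n\bigl(1+p^{k-u-1}\bigr).$$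 -/

import Mathlib

open NumberField Filter Topology
open scoped nonZeroDivisors TensorProduct

/-! ### Number fields and relative class groups -/

/-- The finite extensions of `K₀` inside a fixed algebraic closure of `K₀` (which, for a number
field `K₀`, is an algebraic closure of `ℚ`). -/
abbrev FinExt (K₀ : Type*) [Field K₀] : Type _ :=
  {K : IntermediateField K₀ (AlgebraicClosure K₀) // FiniteDimensional K₀ K}

instance FinExt.finiteDimensional {K₀ : Type*} [Field K₀] (K : FinExt K₀) :
    FiniteDimensional K₀ K.1 := K.2

instance FinExt.numberField {K₀ : Type*} [Field K₀] [NumberField K₀] (K : FinExt K₀) :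
    NumberField K.1 where
  to_charZero := inferInstance
  to_finiteDimensional := FiniteDimensional.trans ℚ K₀ K.1

section ClassNorm

variable (K₀ K : Type*) [Field K₀] [NumberField K₀] [Field K] [NumberField K] [Algebra K₀ K]

/-- The norm of a nonzero ideal of `𝓞 K` is a nonzero ideal of `𝓞 K₀`. -/
noncomputable def nonzeroIdealNorm (I : (Ideal (𝓞 K))⁰) : (Ideal (𝓞 K₀))⁰ :=
  ⟨Ideal.relNorm (𝓞 K₀) (I : Ideal (𝓞 K)), mem_nonZeroDivisors_iff_ne_zero.mpr fun h =>
    nonZeroDivisors.coe_ne_zero I (by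
      rw [Ideal.zero_eq_bot] at h ⊢
      exact Ideal.relNorm_eq_bot_iff.mp h)⟩

theorem nonzeroIdealNorm_mul (I J : (Ideal (𝓞 K))⁰) :
    nonzeroIdealNorm K₀ K (I * J) = nonzeroIdealNorm K₀ K I * nonzeroIdealNorm K₀ K J :=
  Subtype.ext (map_mul (Ideal.relNorm (𝓞 K₀)) (I : Ideal (𝓞 K)) J)

theorem mk0_nonzeroIdealNorm_congr {I J : (Ideal (𝓞 K))⁰}
    (h : ClassGroup.mk0 I = ClassGroup.mk0 J) :
    ClassGroup.mk0 (nonzeroIdealNorm K₀ K I) = ClassGroup.mk0 (nonzeroIdealNorm K₀ K J) := by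
  obtain ⟨x, y, hx, hy, hxy⟩ := ClassGroup.mk0_eq_mk0_iff.mp h
  refine ClassGroup.mk0_eq_mk0_iff.mpr
    ⟨Algebra.intNorm (𝓞 K₀) (𝓞 K) x, Algebra.intNorm (𝓞 K₀) (𝓞 K) y, ?_, ?_, ?_⟩
  · simpa using hx
  · simpa using hy
  · have := congrArg (Ideal.relNorm (𝓞 K₀)) hxy
    rw [map_mul, map_mul, Ideal.relNorm_singleton, Ideal.relNorm_singleton] at this
    exact this

/-- The norm map `Cl_K → Cl_{K₀}`, sending the class of `I` to the class of `N_{K/K₀}(I)`. -/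
noncomputable def classNorm : ClassGroup (𝓞 K) →* ClassGroup (𝓞 K₀) :=
  MonoidHom.mk' (fun c => ClassGroup.mk0
      (nonzeroIdealNorm K₀ K (Function.surjInv ClassGroup.mk0_surjective c))) (by
    intro a b
    rw [← map_mul, ← nonzeroIdealNorm_mul]
    refine mk0_nonzeroIdealNorm_congr K₀ K ?_
    rw [map_mul]
    simp only [Function.surjInv_eq])

theorem classNorm_mk0 (I : (Ideal (𝓞 K))⁰) :
    classNorm K₀ K (ClassGroup.mk0 I) = ClassGroup.mk0 (nonzeroIdealNorm K₀ K I) :=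
  mk0_nonzeroIdealNorm_congr K₀ K (Function.surjInv_eq _ _)

/-- The relative class group `Cl(K/K₀)`: the kernel of the norm map `Cl_K → Cl_{K₀}`. -/
noncomputable def relClassGroup : Subgroup (ClassGroup (𝓞 K)) := (classNorm K₀ K).ker

end ClassNorm

/-! ### Situations -/

section Galois

variable {K₀ : Type*} [Field K₀]

/-- The Galois closure `L` of `K/K₀` (inside the fixed algebraic closure). -/
noncomputable abbrev galClosure (K : FinExt K₀) : IntermediateField K₀ (AlgebraicClosure K₀) :=
  IntermediateField.normalClosure K₀ K.1 (AlgebraicClosure K₀)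

/-- The Galois group `Gal(L/K₀)`. -/
abbrev GalGroup (K : FinExt K₀) : Type _ := galClosure K ≃ₐ[K₀] galClosure K

/-- The action of `Gal(L/K₀)` on the embeddings of `K` into `L` over `K₀`. -/
noncomputable def embPerm (K : FinExt K₀) : GalGroup K →* Equiv.Perm (K.1 →ₐ[K₀] galClosure K) where
  toFun g :=
    { toFun := fun f => (g : galClosure K →ₐ[K₀] galClosure K).comp f
      invFun := fun f => (g.symm : galClosure K →ₐ[K₀] galClosure K).comp f
      left_inv := fun f => by ext x; simp
      right_inv := fun f => by ext x; simp }
  map_one' := by ext f x; simp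
  map_mul' g h := by ext f x; simp

end Galois

/-- A situation `(G, K₀, σ)` over a number field `K₀`: a transitive permutation group `G` of degree
`n ≥ 2` and a signature `σ`, prescribing for every infinite place `v` of `K₀` the number of real
and the number of complex places above `v`. -/
structure Situation (K₀ : Type*) [Field K₀] where
  degree : ℕ
  two_le_degree : 2 ≤ degree
  G : Subgroup (Equiv.Perm (Fin degree))
  transitive : MulAction.IsPretransitive G (Fin degree)
  signature : InfinitePlace K₀ → ℕ × ℕ

/-- The set `𝓚(Σ)` of degree `n` extensions `K/K₀` with signature `σ` whose Galois group (of the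
Galois closure, acting on the embeddings of `K`) is permutation isomorphic to `G`. -/
def Situation.fields {K₀ : Type*} [Field K₀] (S : Situation K₀) : Set (FinExt K₀) :=
  {K | Module.finrank K₀ K.1 = S.degree ∧
    (∃ e : (K.1 →ₐ[K₀] galClosure K) ≃ Fin S.degree,
      (embPerm K).range.map e.permCongrHom.toMonoidHom = S.G) ∧
    ∀ v : InfinitePlace K₀,
      Set.ncard {w : InfinitePlace K.1 | w.comap (algebraMap K₀ K.1) = v ∧ w.IsReal}
        = (S.signature v).1 ∧
      Set.ncard {w : InfinitePlace K.1 | w.comap (algebraMap K₀ K.1) = v ∧ w.IsComplex}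
        = (S.signature v).2}

/-- `HasProbability S P δ`: among the fields `K ∈ 𝓚(Σ)`, ordered by the absolute value of their
discriminant, the proportion of those with property `P` tends to `δ`. -/
def HasProbability {K₀ : Type*} [Field K₀] [NumberField K₀] (S : Situation K₀)
    (P : FinExt K₀ → Prop) (δ : ℝ) : Prop :=
  Tendsto (fun X : ℕ =>
      (Set.ncard {K | K ∈ S.fields ∧ |discr K.1| ≤ (X : ℤ) ∧ P K} : ℝ) /
        (Set.ncard {K | K ∈ S.fields ∧ |discr K.1| ≤ (X : ℤ)} : ℝ))
    atTop (𝓝 δ)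

/-! ### The characters `χ₁`, `χ_E` and the unit multiplicity -/

section Characters

/-- The scalar product `⟨a, b⟩ = |G|⁻¹ ∑ a(g) conj(b(g))` of two functions on a finite group. -/
noncomputable def charInner {G : Type*} (a b : G → ℂ) : ℂ :=
  (Nat.card G : ℂ)⁻¹ * ∑ᶠ g : G, a g * (starRingEnd ℂ) (b g)

variable {K₀ : Type*} [Field K₀]

/-- `χ₁ = χ - 1`, where `χ` is the permutation character of `Gal(L/K₀)` on the embeddings
of `K` into `L`. -/
noncomputable def chiOne (K : FinExt K₀) (g : GalGroup K) : ℂ :=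
  (Nat.card {f : K.1 →ₐ[K₀] galClosure K // embPerm K g f = f} : ℂ) - 1

/-- The action of `g ∈ Gal(L/K₀)` on the unit group `E_L` (written additively). -/
noncomputable def unitAct (K : FinExt K₀) (g : GalGroup K) :
    Additive (𝓞 (galClosure K))ˣ →ₗ[ℤ] Additive (𝓞 (galClosure K))ˣ :=
  (MonoidHom.toAdditive (Units.map
    (RingOfIntegers.mapRingHom g : 𝓞 (galClosure K) →+* 𝓞 (galClosure K)).toMonoidHom)).toIntLinearMap

/-- The character `χ_E` of the `ℚ[Gal(L/K₀)]`-module `ℚ ⊗ E_L`. -/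
noncomputable def chiE (K : FinExt K₀) (g : GalGroup K) : ℂ :=
  (LinearMap.trace ℚ (ℚ ⊗[ℤ] Additive (𝓞 (galClosure K))ˣ) ((unitAct K g).baseChange ℚ) : ℚ)

/-- `φ` is an absolutely irreducible constituent of `χ`: the character of an irreducible complex
representation that has nonzero multiplicity in `χ`. -/
def IsAbsIrredConstituent {G : Type*} [Group G] (χ φ : G → ℂ) : Prop :=
  (∃ (m : ℕ) (ρ : Representation ℂ G (Fin m → ℂ)), ρ.IsIrreducible ∧ φ = ρ.character) ∧
    charInner χ φ ≠ 0

/-- `u` is the unit multiplicity `⟨χ_E, φ⟩` computed from the field `K` and some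
absolutely irreducible constituent `φ` of `χ₁`. -/
def IsUnitMultiplicity (K : FinExt K₀) (u : ℕ) : Prop :=
  ∃ φ : GalGroup K → ℂ, IsAbsIrredConstituent (chiOne K) φ ∧ (u : ℂ) = charInner (chiE K) φ

end Characters

/-! ### The predicted distribution -/

/-- The `p`-rank of an abelian group `A`: the dimension over `𝔽_p` of `A/pA`. -/
noncomputable def pRank (p : ℕ) (A : Type*) [CommGroup A] : ℕ :=
  Module.finrank (ZMod p) (ModN (Additive A) p)

/-- `(q)_k = ∏_{i=1}^k (1 - q^{-i})`. -/
noncomputable def qPoch (q k : ℕ) : ℝ := ∏ i ∈ Finset.Icc 1 k, (1 - ((q : ℝ) ^ i)⁻¹)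

/-- `(q)_∞ = ∏_{i=1}^∞ (1 - q^{-i})`. -/
noncomputable def qPochInf (q : ℕ) : ℝ := ∏' i : ℕ, (1 - ((q : ℝ) ^ (i + 1))⁻¹)

/-- The constant `(p²)_u (p)_∞ / ((p)_u (p²)_∞)`. -/
noncomputable def rankConst (p u : ℕ) : ℝ :=
  (qPoch (p ^ 2) u * qPochInf p) / (qPoch p u * qPochInf (p ^ 2))

/-- The weight `∏_{i=1}^{r+u} (p^i - 1) / p^{r(u+1)} · 1 / (|H|^u |Aut H|)` of a finite abelian
`p`-group `H` of `p`-rank `r`. -/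
noncomputable def sylowWeight (p u : ℕ) (H : Type*) [CommGroup H] : ℝ :=
  (∏ i ∈ Finset.Icc 1 (pRank p H + u), ((p : ℝ) ^ i - 1)) / (p : ℝ) ^ (pRank p H * (u + 1)) *
    (1 / ((Nat.card H : ℝ) ^ u * (Nat.card (MulAut H) : ℝ)))

/-- The constant that makes the weights `sylowWeight p u` a probability distribution on the
isomorphism classes of finite abelian `p`-groups. -/
noncomputable def sylowConst (p u : ℕ) : ℝ :=
  rankConst p u / ∏ i ∈ Finset.Icc 1 u, ((p : ℝ) ^ i - 1)

/-- The Sylow `p`-subgroups of the relative class groups `Cl(K/K₀)`, `K ∈ 𝓚(Σ)`, are distributed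
according to the normalised weights: every finite abelian `p`-group `H` is (up to isomorphism) the
Sylow `p`-subgroup with probability `sylowConst p u * sylowWeight p u H`. -/
def SylowDistribution {K₀ : Type*} [Field K₀] [NumberField K₀] (S : Situation K₀) (p u : ℕ) :
    Prop :=
  ∀ (H : Type) [CommGroup H] [Finite H], IsPGroup p H →
    HasProbability S
      (fun K => ∃ P : Sylow p (relClassGroup K₀ K.1), Nonempty (P ≃* H))
      (sylowConst p u * sylowWeight p u H)

/-- The `p`-rank of `Cl(K/K₀)`, `K ∈ 𝓚(Σ)`, equals `r` with probability `δ`. -/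
def HasRankProbability {K₀ : Type*} [Field K₀] [NumberField K₀] (S : Situation K₀) (p r : ℕ)
    (δ : ℝ) : Prop :=
  HasProbability S (fun K => pRank p (relClassGroup K₀ K.1) = r) δ

/-- The `n`-th higher moment of the distribution of `p`-ranks, i.e. the expectation of
`(p^rank)^n`, exists and equals `m`. -/
def HasHigherMoment {K₀ : Type*} [Field K₀] [NumberField K₀] (S : Situation K₀) (p n : ℕ)
    (m : ℝ) : Prop :=
  ∃ pr : ℕ → ℝ, (∀ r, HasRankProbability S p r (pr r)) ∧
    HasSum (fun r => ((p : ℝ) ^ r) ^ n * pr r) m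

/-! ### Euler's identity -/

section Euler

/-! The hypothesis gives the limit for one group `H` at a time, and infinitely many `H` share a
rank, so limits cannot simply be summed. Two facts repair this. First, finitely many `H` already
bound the lower limit of the proportion of rank `r` from below by anything less than the predicted
value. Second, the predicted values sum to 1, so no mass can escape and the lower bounds are limits
(`tendsto_of_eventually_lower_bound`).

For the first fact, groups of rank `r` are realised as `ℤʳ/pΛ` with `Λ` of `p`-power index. The
lattices giving a fixed `H` number at most `|H|^r (p)_r / |Aut H|`, because they correspond to
orbits of `Aut H` on generating `r`-tuples (`card_lattices_mul_card_mulAut_le`). Weighting each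
lattice by the inverse of this bound cancels `|Aut H|`, and the predicted mass becomes a constant
times `[ℤʳ : Λ]^{-(u+r)}` (`latticeWeight_mul_density`). The sum of these powers over all `Λ` is at
least `(p)_u / (p)_{u+r}` (`le_tsum_primaryLattice`), which is exactly what is needed.

The total mass and all moments come from Euler's series at `z = p^{n-u-1}`: its functional equation
under `z ↦ z/p` turns it into the product of the `1 + z p^{-i}` (`hasSum_moment`). -/

theorem qPoch_zero (q : ℕ) : qPoch q 0 = 1 := by simp [qPoch]

theorem qPoch_succ (q k : ℕ) : qPoch q (k + 1) = qPoch q k * (1 - ((q : ℝ) ^ (k + 1))⁻¹) := by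
  rw [qPoch, qPoch, Finset.prod_Icc_succ_top (by omega)]

theorem one_sub_inv_pow_pos {q : ℕ} (hq : 2 ≤ q) (k : ℕ) : 0 < 1 - ((q : ℝ) ^ (k + 1))⁻¹ := by
  have : (1 : ℝ) < (q : ℝ) ^ (k + 1) := one_lt_pow₀ (by exact_mod_cast hq) (by omega)
  linarith [inv_lt_one_of_one_lt₀ this]

theorem qPoch_pos {q : ℕ} (hq : 2 ≤ q) (k : ℕ) : 0 < qPoch q k := by
  induction k with
  | zero => simp [qPoch_zero]
  | succ k ih => rw [qPoch_succ]; exact mul_pos ih (one_sub_inv_pow_pos hq k)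

theorem summable_inv_pow_succ {q : ℕ} (hq : 2 ≤ q) :
    Summable fun i : ℕ => ‖-((q : ℝ) ^ (i + 1))⁻¹‖ := by
  have hq' : (1 : ℝ) < q := by exact_mod_cast hq
  have := (summable_geometric_of_lt_one (r := (q : ℝ)⁻¹) (by positivity)
    (inv_lt_one_of_one_lt₀ hq')).comp_injective (add_left_injective 1)
  refine this.congr fun i => ?_
  simp only [Function.comp, norm_neg, norm_inv, norm_pow, inv_pow]
  simp

theorem qPochInf_ne_zero {q : ℕ} (hq : 2 ≤ q) : qPochInf q ≠ 0 := by
  have := tprod_one_add_ne_zero_of_summable (f := fun i : ℕ => -((q : ℝ) ^ (i + 1))⁻¹)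
    (fun i => by have := one_sub_inv_pow_pos hq i; rw [← sub_eq_add_neg]; exact this.ne')
    (summable_inv_pow_succ hq)
  simpa only [qPochInf, ← sub_eq_add_neg] using this

theorem tendsto_qPoch {q : ℕ} (hq : 2 ≤ q) : Tendsto (qPoch q) atTop (𝓝 (qPochInf q)) := by
  have := (multipliable_one_add_of_summable (summable_inv_pow_succ hq)).tendsto_prod_tprod_nat
  simp only [← sub_eq_add_neg] at this
  refine this.congr fun n => ?_
  induction n with
  | zero => simp [qPoch_zero]
  | succ n ih => rw [qPoch_succ, Finset.prod_range_succ, ih]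

/-- The terms of Euler's series `∑ z ^ r / (p ^ (r choose 2) (p)_r) = ∏ (1 + z p ^ (-i))`. -/
noncomputable def eulerTerm (p : ℕ) (z : ℝ) (r : ℕ) : ℝ :=
  z ^ r / ((p : ℝ) ^ (r.choose 2) * qPoch p r)

variable {p : ℕ}

theorem eulerTerm_zero (z : ℝ) : eulerTerm p z 0 = 1 := by simp [eulerTerm, qPoch_zero]

theorem eulerTerm_pos (hp : 2 ≤ p) {z : ℝ} (hz : 0 < z) (r : ℕ) : 0 < eulerTerm p z r := by
  have := qPoch_pos hp r
  have : (0 : ℝ) < p := by positivity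
  unfold eulerTerm
  positivity

theorem eulerTerm_succ (hp : 2 ≤ p) (z : ℝ) (r : ℕ) :
    (1 - ((p : ℝ) ^ (r + 1))⁻¹) * eulerTerm p z (r + 1) = z * eulerTerm p (z / p) r := by
  have h1 := (qPoch_pos hp r).ne'
  have h2 := (one_sub_inv_pow_pos hp r).ne'
  have h3 : (p : ℝ) ≠ 0 := by positivity
  have h4 : (r + 1).choose 2 = r + r.choose 2 := by
    rw [Nat.choose_succ_succ' r 1, Nat.choose_one_right]
  rw [eulerTerm, eulerTerm, qPoch_succ, h4, div_pow]
  -- The factor is made an atom so that `field_simp` does not clear the inverse inside it.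
  generalize 1 - ((p : ℝ) ^ (r + 1))⁻¹ = d at h2 ⊢
  rw [pow_add]
  field_simp
  ring

theorem eulerTerm_div (z : ℝ) (r : ℕ) :
    eulerTerm p (z / p) r = ((p : ℝ) ^ r)⁻¹ * eulerTerm p z r := by
  rw [eulerTerm, eulerTerm, div_pow]; ring

theorem summable_eulerTerm (hp : 2 ≤ p) {z : ℝ} (hz : 0 < z) : Summable (eulerTerm p z) := by
  have hp' : (1 : ℝ) < p := by exact_mod_cast hp
  refine summable_of_ratio_test_tendsto_lt_one (l := 0) one_pos
    (Eventually.of_forall fun r => (eulerTerm_pos hp hz r).ne') ?_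
  have h0 : Tendsto (fun r : ℕ => ((p : ℝ)⁻¹) ^ r) atTop (𝓝 0) :=
    tendsto_pow_atTop_nhds_zero_of_lt_one (by positivity) (inv_lt_one_of_one_lt₀ hp')
  have h1 := (h0.const_mul z).div ((h0.comp (tendsto_add_atTop_nat 1)).const_sub 1) (by simp)
  simp only [mul_zero, zero_div] at h1
  refine h1.congr fun r => ?_
  have ht := eulerTerm_pos hp hz r
  have ht' := eulerTerm_pos hp hz (r + 1)
  have hd := one_sub_inv_pow_pos hp r
  have h2 := eulerTerm_succ hp z r
  rw [eulerTerm_div] at h2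
  rw [Real.norm_of_nonneg ht.le, Real.norm_of_nonneg ht'.le]
  simp only [Function.comp, inv_pow, Pi.div_apply]
  rw [div_eq_div_iff hd.ne' ht.ne']
  linarith

/-- The `r`-th terms at `z` and `z / p` differ by the factor `p ^ (-r)`, so the recursion
`eulerTerm_succ` makes the difference of the two series telescope into a shifted copy of the second,
times `z`. -/
theorem tsum_eulerTerm (hp : 2 ≤ p) {z : ℝ} (hz : 0 < z) :
    ∑' r, eulerTerm p z r = (1 + z) * ∑' r, eulerTerm p (z / p) r := by
  have hp' : (0 : ℝ) < p := by positivity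
  have hs := summable_eulerTerm hp hz
  have hs' := summable_eulerTerm hp (div_pos hz hp')
  have h1 : ∑' r, eulerTerm p z r - ∑' r, eulerTerm p (z / p) r
      = z * ∑' r, eulerTerm p (z / p) r := by
    rw [← hs.tsum_sub hs', (hs.sub hs').tsum_eq_zero_add, ← tsum_mul_left]
    simp only [eulerTerm_zero, sub_self, zero_add]
    refine tsum_congr fun r => ?_
    rw [← eulerTerm_succ hp, eulerTerm_div]
    ring
  linarith

theorem tsum_eulerTerm_eq_prod (hp : 2 ≤ p) {z : ℝ} (hz : 0 < z) (N : ℕ) :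
    ∑' r, eulerTerm p z r
      = (∏ i ∈ Finset.range N, (1 + z / (p : ℝ) ^ i)) * ∑' r, eulerTerm p (z / (p : ℝ) ^ N) r := by
  have hp' : (0 : ℝ) < p := by positivity
  induction N with
  | zero => simp
  | succ N ih =>
    rw [ih, tsum_eulerTerm hp (by positivity), Finset.prod_range_succ, pow_succ, div_div, mul_assoc]

/-- Dominated convergence: the series at `z` majorises all the others, and at argument 0 only the
term `r = 0` survives. -/
theorem tendsto_tsum_eulerTerm (hp : 2 ≤ p) {z : ℝ} (hz : 0 < z) :
    Tendsto (fun N : ℕ => ∑' r, eulerTerm p (z / (p : ℝ) ^ N) r) atTop (𝓝 1) := by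
  have hp' : (1 : ℝ) < p := by exact_mod_cast hp
  have h0 : Tendsto (fun r : ℕ => ((p : ℝ)⁻¹) ^ r) atTop (𝓝 0) :=
    tendsto_pow_atTop_nhds_zero_of_lt_one (by positivity) (inv_lt_one_of_one_lt₀ hp')
  have h1 : Tendsto (fun N : ℕ => z / (p : ℝ) ^ N) atTop (𝓝 0) := by
    simpa [div_eq_mul_inv] using h0.const_mul z
  have := tendsto_tsum_of_dominated_convergence (𝓕 := atTop)
    (f := fun (N : ℕ) r => eulerTerm p (z / (p : ℝ) ^ N) r) (g := fun r => eulerTerm p 0 r)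
    (bound := eulerTerm p z) (summable_eulerTerm hp hz)
    (fun r => by
      unfold eulerTerm
      exact (h1.pow r).div_const _)
    (Eventually.of_forall fun N r => by
      rw [Real.norm_of_nonneg (eulerTerm_pos hp (by positivity) r).le]
      have := qPoch_pos hp r
      unfold eulerTerm
      gcongr
      exact div_le_self hz.le (one_le_pow₀ hp'.le))
  rw [tsum_eq_single 0 (fun r hr => by simp [eulerTerm, hr]), eulerTerm_zero] at this
  exact this

/-- Since `1 + x = (1 - x²) / (1 - x)` with `x = p ^ (-(u + i + 1))`, each factor is a quotient of
consecutive factors of `(p²)` and `(p)`. -/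
theorem prod_one_add_eq_qPoch (hp : 2 ≤ p) (u N : ℕ) :
    ∏ i ∈ Finset.range N, (1 + ((p : ℝ) ^ (u + 1))⁻¹ / (p : ℝ) ^ i)
      = qPoch (p ^ 2) (u + N) / qPoch p (u + N) * (qPoch p u / qPoch (p ^ 2) u) := by
  have hp2 : 2 ≤ p ^ 2 := by nlinarith
  have h1 := (qPoch_pos hp u).ne'
  have h2 := (qPoch_pos hp2 u).ne'
  induction N with
  | zero => simp; field_simp
  | succ N ih =>
    have h3 := (qPoch_pos hp (u + N)).ne'
    have h4 := (one_sub_inv_pow_pos hp (u + N)).ne'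
    rw [Finset.prod_range_succ, ih, ← add_assoc, qPoch_succ, qPoch_succ]
    have e1 : 1 - (((p ^ 2 : ℕ) : ℝ) ^ (u + N + 1))⁻¹
        = (1 - ((p : ℝ) ^ (u + N + 1))⁻¹) * (1 + ((p : ℝ) ^ (u + N + 1))⁻¹) := by
      push_cast; rw [← pow_mul, mul_comm 2, pow_mul]; ring
    have e2 : ((p : ℝ) ^ (u + 1))⁻¹ / (p : ℝ) ^ N = ((p : ℝ) ^ (u + N + 1))⁻¹ := by
      rw [div_eq_mul_inv, ← mul_inv, ← pow_add]; congr 2; omega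
    rw [e1, e2]
    generalize 1 - ((p : ℝ) ^ (u + N + 1))⁻¹ = d at h4 ⊢
    field_simp

theorem rankConst_mul_tsum_eulerTerm (hp : 2 ≤ p) (u : ℕ) :
    rankConst p u * ∑' r, eulerTerm p ((p : ℝ) ^ (u + 1))⁻¹ r = 1 := by
  have hp2 : 2 ≤ p ^ 2 := by nlinarith
  have hp' : (0 : ℝ) < p := by positivity
  have hz : (0 : ℝ) < ((p : ℝ) ^ (u + 1))⁻¹ := by positivity
  have h1 := (qPoch_pos hp u).ne'
  have h2 := (qPoch_pos hp2 u).ne'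
  have h3 := qPochInf_ne_zero hp
  have h4 := qPochInf_ne_zero hp2
  have hl : Tendsto (fun N : ℕ => u + N) atTop atTop := tendsto_add_atTop_nat u |>.congr fun n =>
    add_comm n u
  have ht := ((((tendsto_qPoch hp2).comp hl).div ((tendsto_qPoch hp).comp hl) h3).mul_const
    (qPoch p u / qPoch (p ^ 2) u)).mul (tendsto_tsum_eulerTerm hp hz)
  have hc : Tendsto (fun _ : ℕ => ∑' r, eulerTerm p ((p : ℝ) ^ (u + 1))⁻¹ r) atTop
      (𝓝 (∑' r, eulerTerm p ((p : ℝ) ^ (u + 1))⁻¹ r)) := tendsto_const_nhds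
  rw [tendsto_nhds_unique hc (ht.congr fun N => ?_), rankConst]
  · field_simp
  · rw [tsum_eulerTerm_eq_prod hp hz N, prod_one_add_eq_qPoch hp]
    simp

/-- Raising `n` by one multiplies the argument by `p`, and the functional equation contributes one
factor. -/
theorem rankConst_mul_tsum_eulerTerm_pow (hp : 2 ≤ p) (u n : ℕ) :
    rankConst p u * ∑' r, eulerTerm p ((p : ℝ) ^ n * ((p : ℝ) ^ (u + 1))⁻¹) r
      = ∏ k ∈ Finset.Icc 1 n, (1 + (p : ℝ) ^ ((k : ℤ) - (u : ℤ) - 1)) := by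
  have hp' : (0 : ℝ) < p := by positivity
  induction n with
  | zero => simpa using rankConst_mul_tsum_eulerTerm hp u
  | succ n ih =>
    rw [Finset.prod_Icc_succ_top (by omega), ← ih, tsum_eulerTerm hp (by positivity)]
    have e1 : (p : ℝ) ^ (n + 1) * ((p : ℝ) ^ (u + 1))⁻¹ / p
        = (p : ℝ) ^ n * ((p : ℝ) ^ (u + 1))⁻¹ := by field_simp; ring
    have e2 : (p : ℝ) ^ (((n + 1 : ℕ) : ℤ) - (u : ℤ) - 1)
        = (p : ℝ) ^ (n + 1) * ((p : ℝ) ^ (u + 1))⁻¹ := by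
      rw [sub_sub, zpow_sub₀ hp'.ne', zpow_natCast, div_eq_mul_inv]; norm_cast
    rw [e1, e2]; ring

theorem rankDensity_eq_eulerTerm (hp : 2 ≤ p) (u r : ℕ) :
    1 / ((p : ℝ) ^ (((r : ℝ) * (r + 2 * u + 1)) / 2) * qPoch p r)
      = eulerTerm p ((p : ℝ) ^ (u + 1))⁻¹ r := by
  have e : ((r : ℝ) * (r + 2 * u + 1)) / 2 = ((r.choose 2 + (u + 1) * r : ℕ) : ℝ) := by
    push_cast; rw [Nat.cast_choose_two]; ring
  rw [e, Real.rpow_natCast, eulerTerm, pow_add, pow_mul, inv_pow]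
  have h1 := (qPoch_pos hp r).ne'
  have hp' : (0 : ℝ) < p := by positivity
  field_simp

theorem hasSum_moment (hp : 2 ≤ p) (u n : ℕ) :
    HasSum (fun r : ℕ => ((p : ℝ) ^ r) ^ n *
      (rankConst p u * (1 / ((p : ℝ) ^ (((r : ℝ) * (r + 2 * u + 1)) / 2) * qPoch p r))))
      (∏ k ∈ Finset.Icc 1 n, (1 + (p : ℝ) ^ ((k : ℤ) - (u : ℤ) - 1))) := by
  have hp' : (0 : ℝ) < p := by positivity
  rw [← rankConst_mul_tsum_eulerTerm_pow hp u n]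
  refine ((summable_eulerTerm hp (by positivity)).hasSum.mul_left _).congr_fun ?_
  intro r
  rw [rankDensity_eq_eulerTerm hp, eulerTerm, eulerTerm, mul_pow, ← pow_mul, ← pow_mul, mul_comm n]
  ring

end Euler

/-! ### Sublattices of `ℤⁿ` of `p`-power index -/

section Lattice

variable {n : ℕ}

/-- The sublattice of `ℤⁿ⁺¹` with intersection `Λ` with `0 × ℤⁿ` and projection `dℤ` to the first
coordinate, for which the class `x` lies over `d`. -/
def extendLattice (Λ : AddSubgroup (Fin n → ℤ)) (d : ℤ) (x : (Fin n → ℤ) ⧸ Λ) :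
    AddSubgroup (Fin (n + 1) → ℤ) where
  carrier := {v | ∃ a : ℤ, v 0 = d * a ∧ QuotientAddGroup.mk' Λ (fun i => v i.succ) = a • x}
  zero_mem' := ⟨0, by simp, by
    rw [zero_zsmul, ← map_zero (QuotientAddGroup.mk' Λ)]; rfl⟩
  add_mem' := by
    rintro v w ⟨a, ha, ha'⟩ ⟨b, hb, hb'⟩
    refine ⟨a + b, by simp [ha, hb, mul_add], ?_⟩
    rw [add_zsmul, ← ha', ← hb', ← map_add]; rfl
  neg_mem' := by
    rintro v ⟨a, ha, ha'⟩
    refine ⟨-a, by simp [ha], ?_⟩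
    rw [neg_zsmul, ← ha', ← map_neg]; rfl

theorem cons_mem_extendLattice {Λ : AddSubgroup (Fin n → ℤ)} {d : ℤ} {x : (Fin n → ℤ) ⧸ Λ}
    {b : ℤ} {m : Fin n → ℤ} :
    (Fin.cons b m : Fin (n + 1) → ℤ) ∈ extendLattice Λ d x ↔
      ∃ a : ℤ, b = d * a ∧ QuotientAddGroup.mk' Λ m = a • x :=
  Iff.rfl

theorem cons_zero_mem_extendLattice {Λ : AddSubgroup (Fin n → ℤ)} {d : ℤ} (hd : d ≠ 0)
    {x : (Fin n → ℤ) ⧸ Λ} {m : Fin n → ℤ} :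
    (Fin.cons 0 m : Fin (n + 1) → ℤ) ∈ extendLattice Λ d x ↔ m ∈ Λ := by
  rw [cons_mem_extendLattice]
  constructor
  · rintro ⟨a, ha, h⟩
    have : a = 0 := by simpa [hd] using ha.symm
    rw [this, zero_zsmul] at h
    exact (QuotientAddGroup.eq_zero_iff m).mp h
  · intro h
    exact ⟨0, by simp, by rw [zero_zsmul]; exact (QuotientAddGroup.eq_zero_iff m).mpr h⟩

theorem cons_self_mem_extendLattice {Λ : AddSubgroup (Fin n → ℤ)} {d : ℤ} (hd : d ≠ 0)
    {x : (Fin n → ℤ) ⧸ Λ} {m : Fin n → ℤ} :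
    (Fin.cons d m : Fin (n + 1) → ℤ) ∈ extendLattice Λ d x ↔ QuotientAddGroup.mk' Λ m = x := by
  rw [cons_mem_extendLattice]
  constructor
  · rintro ⟨a, ha, h⟩
    have : a = 1 := by
      have : d * a = d * 1 := by rw [mul_one]; exact ha.symm
      exact mul_left_cancel₀ hd this
    rwa [this, one_zsmul] at h
  · intro h
    exact ⟨1, by simp, by rwa [one_zsmul]⟩

theorem dvd_of_extendLattice_le {Λ Λ' : AddSubgroup (Fin n → ℤ)} {d d' : ℤ} (hd : d ≠ 0)
    {x : (Fin n → ℤ) ⧸ Λ} {x' : (Fin n → ℤ) ⧸ Λ'}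
    (h : extendLattice Λ d x ≤ extendLattice Λ' d' x') : d' ∣ d := by
  obtain ⟨m, hm⟩ := QuotientAddGroup.mk'_surjective Λ x
  obtain ⟨a, ha, -⟩ := cons_mem_extendLattice.mp (h ((cons_self_mem_extendLattice hd).mpr hm))
  exact ⟨a, ha⟩

/-- The vectors with first coordinate in `dℤ` form a subgroup `A` of index `d`. On `A`, the map `g`
sending `v` to the class of its tail minus `(v 0 / d) • x` is onto `ℤⁿ/Λ` and has the extended
lattice as kernel. -/
theorem index_extendLattice (Λ : AddSubgroup (Fin n → ℤ)) {d : ℕ} (hd : d ≠ 0)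
    (x : (Fin n → ℤ) ⧸ Λ) : (extendLattice Λ d x).index = d * Λ.index := by
  have hd' : (d : ℤ) ≠ 0 := by exact_mod_cast hd
  let e : (Fin (n + 1) → ℤ) →+ ℤ := Pi.evalAddMonoidHom _ 0
  have he : Function.Surjective e := fun a => ⟨Fin.cons a 0, rfl⟩
  let A : AddSubgroup (Fin (n + 1) → ℤ) := (AddSubgroup.zmultiples (d : ℤ)).comap e
  have hA : A.index = d := by
    rw [AddSubgroup.index_comap_of_surjective _ he, Int.index_zmultiples, Int.natAbs_natCast]
  have hmem : ∀ v : A, (d : ℤ) ∣ v.1 0 := fun v => Int.mem_zmultiples_iff.mp v.2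
  let t : (Fin (n + 1) → ℤ) →+ (Fin n → ℤ) :=
    { toFun := fun v i => v i.succ, map_zero' := rfl, map_add' := fun _ _ => rfl }
  let g : A →+ (Fin n → ℤ) ⧸ Λ :=
    AddMonoidHom.mk' (fun v => QuotientAddGroup.mk' Λ (t v.1) - (v.1 0 / (d : ℤ)) • x) (by
      intro v w
      have : (v + w).1 0 / (d : ℤ) = v.1 0 / (d : ℤ) + w.1 0 / (d : ℤ) :=
        Int.add_ediv_of_dvd_left (hmem v)
      rw [this, AddSubgroup.coe_add, map_add, map_add, add_zsmul]
      abel)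
  have hle : extendLattice Λ d x ≤ A := by
    rintro v ⟨a, ha, -⟩
    exact Int.mem_zmultiples_iff.mpr ⟨a, ha⟩
  have hker : (extendLattice Λ d x).addSubgroupOf A = g.ker := by
    ext v
    obtain ⟨b, hb⟩ := hmem v
    rw [AddSubgroup.mem_addSubgroupOf, AddMonoidHom.mem_ker]
    have hg : g v = QuotientAddGroup.mk' Λ (t v.1) - b • x := by
      simp only [g, AddMonoidHom.mk'_apply]
      rw [hb, Int.mul_ediv_cancel_left _ hd']
    rw [hg, sub_eq_zero]
    constructor
    · rintro ⟨a, ha, h⟩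
      have : a = b := mul_left_cancel₀ hd' (ha.symm.trans hb)
      rwa [this] at h
    · intro h
      exact ⟨b, hb, h⟩
  have hsurj : Function.Surjective g := by
    intro y
    obtain ⟨m, hm⟩ := QuotientAddGroup.mk'_surjective Λ y
    refine ⟨⟨Fin.cons 0 m, Int.mem_zmultiples_iff.mpr (dvd_zero _)⟩, ?_⟩
    simp only [g, AddMonoidHom.mk'_apply, Fin.cons_zero, Int.zero_ediv, zero_zsmul, sub_zero]
    exact hm
  rw [← AddSubgroup.relIndex_mul_index hle, hA, AddSubgroup.relIndex, hker, AddSubgroup.index_ker,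
    AddMonoidHom.range_eq_top_of_surjective g hsurj, AddSubgroup.card_top, mul_comm]
  rfl

/-- The subgroups of `ℤⁿ` of `p`-power index. -/
abbrev PrimaryLattice (p n : ℕ) : Type :=
  {Λ : AddSubgroup (Fin n → ℤ) // ∃ k, Λ.index = p ^ k}

variable {p : ℕ}

theorem PrimaryLattice.index_pos (hp : 2 ≤ p) (Λ : PrimaryLattice p n) : 0 < Λ.1.index := by
  obtain ⟨k, hk⟩ := Λ.2
  rw [hk]; positivity

/-- `extendLattice` as a map on lattices of `p`-power index. -/
def PrimaryLattice.extend (hp : 2 ≤ p)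
    (y : (Λ : PrimaryLattice p n) × (ℕ × (Fin n → ℤ) ⧸ Λ.1)) : PrimaryLattice p (n + 1) :=
  ⟨extendLattice y.1.1 ((p ^ y.2.1 : ℕ) : ℤ) y.2.2, by
    obtain ⟨k, hk⟩ := y.1.2
    exact ⟨y.2.1 + k, by rw [index_extendLattice _ (by positivity), hk, pow_add]⟩⟩

/-- The lattice determines its data: `Λ` is the slice over 0, `p ^ j` generates the first
coordinates, and `x` is the class lying over `p ^ j`. -/
theorem PrimaryLattice.extend_injective (hp : 2 ≤ p) :
    Function.Injective (PrimaryLattice.extend (n := n) hp) := by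
  rintro ⟨⟨Λ, hΛ⟩, j, x⟩ ⟨⟨Λ', hΛ'⟩, j', x'⟩ h
  have h : extendLattice Λ ((p ^ j : ℕ) : ℤ) x = extendLattice Λ' ((p ^ j' : ℕ) : ℤ) x' :=
    congrArg Subtype.val h
  have h0 : ∀ j : ℕ, ((p ^ j : ℕ) : ℤ) ≠ 0 := fun j => by positivity
  obtain rfl : Λ = Λ' := by
    ext m
    rw [← cons_zero_mem_extendLattice (h0 j) (x := x), h, cons_zero_mem_extendLattice (h0 j')]
  obtain rfl : j = j' := by
    have h1 := Int.natCast_dvd_natCast.mp (dvd_of_extendLattice_le (h0 j) h.le)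
    have h2 := Int.natCast_dvd_natCast.mp (dvd_of_extendLattice_le (h0 j') h.ge)
    exact Nat.pow_right_injective hp (Nat.dvd_antisymm h2 h1)
  obtain rfl : x = x' := by
    obtain ⟨m, hm⟩ := QuotientAddGroup.mk'_surjective Λ x
    have hm' := (cons_self_mem_extendLattice (h0 j)).mpr hm
    rw [h, cons_self_mem_extendLattice (h0 j)] at hm'
    exact hm.symm.trans hm'
  rfl

theorem tsum_ofReal_geometric {a b : ℝ} (ha : 0 ≤ a) (ha' : a < 1) (hb : 0 ≤ b) :
    ∑' j : ℕ, ENNReal.ofReal (a ^ j * b) = ENNReal.ofReal ((1 - a)⁻¹) * ENNReal.ofReal b := by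
  rw [← ENNReal.ofReal_tsum_of_nonneg (fun j => by positivity)
    ((summable_geometric_of_lt_one ha ha').mul_right b), tsum_mul_right,
    tsum_geometric_of_lt_one ha ha', ENNReal.ofReal_mul]
  exact inv_nonneg.mpr (by linarith)

/-- Induction on the dimension. Over a fixed `Λ`, the choices of `j` give a geometric series of
ratio `p ^ (-(u + n + 1))`. Injectivity of the extension suffices for a lower bound, and working in
`ENNReal` avoids any summability question. -/
theorem le_tsum_primaryLattice (hp : 2 ≤ p) (u n : ℕ) :
    ENNReal.ofReal (qPoch p u / qPoch p (u + n)) ≤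
      ∑' Λ : PrimaryLattice p n, ENNReal.ofReal (((Λ.1.index : ℝ) ^ (u + n))⁻¹) := by
  induction n with
  | zero =>
    refine le_trans ?_ (ENNReal.le_tsum ⟨⊤, 0, by simp⟩)
    simp [div_self (qPoch_pos hp u).ne']
  | succ n ih =>
    have hq := one_sub_inv_pow_pos hp (u + n)
    refine le_trans ?_ (ENNReal.tsum_comp_le_tsum_of_injective
      (PrimaryLattice.extend_injective (n := n) hp) _)
    have hterm : ∀ Λ : PrimaryLattice p n,
        ∑' y : ℕ × (Fin n → ℤ) ⧸ Λ.1,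
          ENNReal.ofReal (((((PrimaryLattice.extend hp ⟨Λ, y⟩).1.index : ℕ) : ℝ)
            ^ (u + (n + 1)))⁻¹)
        = ENNReal.ofReal ((1 - ((p : ℝ) ^ (u + n + 1))⁻¹)⁻¹) *
          ENNReal.ofReal (((Λ.1.index : ℝ) ^ (u + n))⁻¹) := by
      intro Λ
      have hpos := Λ.index_pos hp
      have hpos' : (0 : ℝ) < Λ.1.index := by exact_mod_cast hpos
      have : Finite ((Fin n → ℤ) ⧸ Λ.1) := Nat.finite_of_card_ne_zero hpos.ne'
      rw [← tsum_ofReal_geometric (by positivity) (by linarith) (by positivity),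
        ENNReal.tsum_prod']
      refine tsum_congr fun j => ?_
      have hidx : ∀ x : (Fin n → ℤ) ⧸ Λ.1,
          (PrimaryLattice.extend hp ⟨Λ, j, x⟩).1.index = p ^ j * Λ.1.index :=
        fun x => index_extendLattice _ (by positivity) x
      simp only [hidx]
      rw [ENNReal.tsum_const, ENat.card_eq_coe_natCard]
      -- The number of classes `x` is the index of `Λ`; this factor lowers the exponent from `u + n
      -- + 1` to `u + n`.
      change ((Λ.1.index : ℕ∞) : ENNReal) * _ = _
      rw [ENat.toENNReal_coe, ← ENNReal.ofReal_natCast, ← ENNReal.ofReal_mul (by positivity)]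
      congr 1
      push_cast
      rw [inv_pow, ← pow_mul, mul_pow, ← pow_mul, mul_comm j, ← add_assoc,
        pow_succ (Λ.1.index : ℝ)]
      field_simp
    rw [ENNReal.tsum_sigma']
    simp only [hterm]
    rw [ENNReal.tsum_mul_left]
    refine le_trans (le_of_eq ?_) (mul_le_mul_right ih _)
    rw [← ENNReal.ofReal_mul (inv_nonneg.mpr hq.le), ← add_assoc, qPoch_succ]
    congr 1
    have := (qPoch_pos hp (u + n)).ne'
    have := hq.ne'
    generalize 1 - ((p : ℝ) ^ (u + n + 1))⁻¹ = d at this ⊢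
    field_simp

theorem exists_finset_primaryLattice (hp : 2 ≤ p) (u n : ℕ) {B : ℝ}
    (hB : B < qPoch p u / qPoch p (u + n)) :
    ∃ F : Finset (PrimaryLattice p n), B < ∑ Λ ∈ F, ((Λ.1.index : ℝ) ^ (u + n))⁻¹ := by
  rcases lt_or_ge B 0 with h0 | h0
  -- Negative bounds are treated apart because `ENNReal.ofReal` truncates them.
  · exact ⟨∅, by simpa using h0⟩
  have h := le_tsum_primaryLattice hp u n
  rw [ENNReal.tsum_eq_iSup_sum] at h
  have h1 := ((ENNReal.ofReal_lt_ofReal_iff (h0.trans_lt hB)).mpr hB).trans_le h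
  obtain ⟨F, hF⟩ := lt_iSup_iff.mp h1
  refine ⟨F, ?_⟩
  rw [← ENNReal.ofReal_sum_of_nonneg (fun _ _ => by positivity)] at hF
  exact (ENNReal.ofReal_lt_ofReal_iff_of_nonneg h0).mp hF

end Lattice

/-! ### `p`-ranks of finite abelian groups -/

section Rank

variable {p : ℕ}

/-- Multiplication by `p` on an additive commutative group. -/
abbrev mulHom (p : ℕ) (G : Type*) [AddCommGroup G] : G →+ G :=
  (LinearMap.lsmul ℤ G p).toAddMonoidHom

theorem mulHom_apply {G : Type*} [AddCommGroup G] (g : G) : mulHom p G g = p • g := by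
  simp [mulHom]

theorem index_range_mulHom (G : Type*) [AddCommGroup G] :
    (mulHom p G).range.index = Nat.card (ModN G p) :=
  rfl

/-- Kernel and cokernel of an endomorphism of a finite group have the same order. Torsion is easier
to compare between a group and its Sylow subgroup. -/
theorem card_modN_eq_card_torsion (G : Type*) [AddCommGroup G] [Finite G] :
    Nat.card (ModN G p) = Nat.card {g : G // p • g = 0} := by
  have h1 := (mulHom p G).range.card_mul_index
  have h2 := (mulHom p G).ker.card_mul_index
  rw [AddSubgroup.index_ker, ← h1, mul_comm] at h2
  rw [← index_range_mulHom, ← Nat.eq_of_mul_eq_mul_left Nat.card_pos h2]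
  exact Nat.card_congr (Equiv.subtypeEquivRight fun g => by
    rw [AddMonoidHom.mem_ker, mulHom_apply])

theorem pow_pRank (hp : p.Prime) (A : Type*) [CommGroup A] [Finite A] :
    p ^ pRank p A = Nat.card (ModN (Additive A) p) := by
  have : Fact p.Prime := ⟨hp⟩
  have : Finite (ModN (Additive A) p) := Quotient.finite _
  rw [pRank, Module.natCard_eq_pow_finrank (K := ZMod p), Nat.card_zmod]

theorem pRank_sylow (hp : p.Prime) {A H : Type*} [CommGroup A] [Finite A] [CommGroup H]
    (P : Sylow p A) (e : P ≃* H) : pRank p A = pRank p H := by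
  have : Fact p.Prime := ⟨hp⟩
  have : Finite H := Finite.of_equiv _ e.toEquiv
  refine Nat.pow_right_injective hp.two_le ?_
  simp only [pow_pRank hp, card_modN_eq_card_torsion]
  symm
  refine Nat.card_eq_of_bijective (fun h : {h : Additive H // p • h = 0} =>
    (⟨Additive.ofMul (e.symm h.1.toMul : A), ?_⟩ : {a : Additive A // p • a = 0})) ⟨?_, ?_⟩
  · have h0 : h.1.toMul ^ p = 1 := h.2
    have : ((e.symm h.1.toMul : A)) ^ p = 1 := by
      rw [← Subgroup.coe_pow, ← map_pow, h0, map_one, Subgroup.coe_one]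
    exact this
  · intro h h' hh
    have : (e.symm h.1.toMul : A) = e.symm h'.1.toMul := congrArg (fun a => a.1.toMul) hh
    exact Subtype.ext (e.symm.injective (Subtype.ext this))
  · rintro ⟨a, ha⟩
    have ha' : a.toMul ^ p = 1 := ha
    have hz : IsPGroup p (Subgroup.zpowers a.toMul) := by
      rintro ⟨_, k, rfl⟩
      refine ⟨1, Subtype.ext ?_⟩
      change (a.toMul ^ k) ^ p ^ 1 = 1
      rw [pow_one, ← zpow_natCast, zpow_comm, zpow_natCast, ha', one_zpow]
    -- The join of `P` with the `p`-group generated by `a` is again a `p`-group, so by maximality it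
    -- equals `P`, which therefore contains `a`.
    have hsup := P.is_maximal' (P.2.to_sup_of_normal_right hz) le_sup_left
    have hmem : a.toMul ∈ (P : Subgroup A) := by
      rw [← hsup]
      exact Subgroup.mem_sup_right (Subgroup.mem_zpowers _)
    refine ⟨⟨Additive.ofMul (e ⟨a.toMul, hmem⟩), ?_⟩, Subtype.ext ?_⟩
    · have : e ⟨a.toMul, hmem⟩ ^ p = 1 := by
        rw [← map_pow, ← map_one e]
        exact congrArg e (Subtype.ext ha')
      exact this
    · simp

theorem card_modN_of_surjective [NeZero p] {r : ℕ} {G : Type*} [AddCommGroup G]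
    {φ : (Fin r → ℤ) →+ G} (hφ : Function.Surjective φ)
    (hker : φ.ker ≤ (mulHom p (Fin r → ℤ)).range) : Nat.card (ModN G p) = p ^ r := by
  have h : (mulHom p G).range.comap φ = (mulHom p (Fin r → ℤ)).range := by
    ext x
    constructor
    · rintro ⟨y, hy⟩
      obtain ⟨y, rfl⟩ := hφ y
      have hx : x - p • y ∈ φ.ker := by
        rw [AddMonoidHom.mem_ker, map_sub, map_nsmul, ← hy, mulHom_apply, sub_self]
      obtain ⟨z, hz⟩ := hker hx
      refine ⟨z + y, ?_⟩
      rw [map_add, hz, mulHom_apply, sub_add_cancel]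
    · rintro ⟨y, rfl⟩
      exact ⟨φ y, by rw [mulHom_apply, mulHom_apply, map_nsmul]⟩
  rw [← index_range_mulHom, ← AddSubgroup.index_comap_of_surjective _ hφ, h, index_range_mulHom,
    ModN.natCard_eq]
  simp

/-- For prime `p` the left side counts the ordered bases of `𝔽_p^r`; factor `i` is `p ^ r (1 - p ^
(-(r - i)))`, hence the reversal of the product. -/
theorem prod_pow_sub_pow (hp : 2 ≤ p) (r : ℕ) :
    ((∏ i : Fin r, (p ^ r - p ^ i.val) : ℕ) : ℝ) = ((p : ℝ) ^ r) ^ r * qPoch p r := by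
  have hp' : (0 : ℝ) < p := by positivity
  have hq : qPoch p r = ∏ i ∈ Finset.range r, (1 - ((p : ℝ) ^ (i + 1))⁻¹) := by
    rw [qPoch, Finset.range_eq_Ico, Finset.prod_Ico_add' (fun i => 1 - ((p : ℝ) ^ i)⁻¹)]
    rfl
  rw [hq, ← Finset.prod_range_reflect, Fin.prod_univ_eq_prod_range (fun i => p ^ r - p ^ i),
    Nat.cast_prod]
  conv_rhs => rw [← Finset.card_range r, ← Finset.prod_const, Finset.card_range,
    ← Finset.prod_mul_distrib]
  refine Finset.prod_congr rfl fun i hi => ?_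
  have hi := Finset.mem_range.mp hi
  rw [Nat.cast_sub (Nat.pow_le_pow_right (by omega) hi.le), mul_sub, mul_one]
  have h : (p : ℝ) ^ r = (p : ℝ) ^ i * (p : ℝ) ^ (r - 1 - i + 1) := by
    rw [← pow_add]; congr 1; omega
  rw [h]
  push_cast
  field_simp
  rw [h]
  ring

/-- The number of generating `r`-tuples of a finite abelian group `G` with `|G/pG| = p ^ r` is at
most `|G| ^ r (p)_r`. -/
theorem card_generating_le (hp : p.Prime) {r : ℕ} {G : Type*} [AddCommGroup G] [Finite G]
    (hG : Nat.card (ModN G p) = p ^ r) :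
    (Nat.card {f : Fin r → G // AddSubgroup.closure (Set.range f) = ⊤} : ℝ)
      ≤ (Nat.card G : ℝ) ^ r * qPoch p r := by
  classical
  have : Fact p.Prime := ⟨hp⟩
  have : Finite (ModN G p) := Quotient.finite _
  have hfin : Module.finrank (ZMod p) (ModN G p) = r := by
    rw [Module.natCard_eq_pow_finrank (K := ZMod p), Nat.card_zmod] at hG
    exact Nat.pow_right_injective hp.two_le hG
  have hπ : Function.Surjective (ModN.mkQ (G := G) p) := Submodule.mkQ_surjective _
  have hLI : ∀ f : Fin r → G, AddSubgroup.closure (Set.range f) = ⊤ →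
      LinearIndependent (ZMod p) (fun i => ModN.mkQ p (f i)) := by
    intro f hf
    refine linearIndependent_of_top_le_span_of_card_eq_finrank ?_ (by simp [hfin])
    intro v _
    obtain ⟨g, rfl⟩ := hπ v
    have hg : g ∈ AddSubgroup.closure (Set.range f) := hf ▸ AddSubgroup.mem_top g
    have hle : AddSubgroup.closure (Set.range f) ≤ (Submodule.span (ZMod p)
        (Set.range fun i => ModN.mkQ p (f i))).toAddSubgroup.comap (ModN.mkQ p) := by
      rw [AddSubgroup.closure_le]
      rintro _ ⟨i, rfl⟩
      exact Submodule.subset_span ⟨i, rfl⟩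
    exact hle hg
  have hmem : ∀ g : G, g - Function.surjInv hπ (ModN.mkQ p g) ∈ (mulHom p G).range := by
    intro g
    have h := Function.surjInv_eq hπ (ModN.mkQ p g)
    have : ModN.mkQ p (g - Function.surjInv hπ (ModN.mkQ p g)) = 0 := by
      rw [map_sub, h, sub_self]
    exact (Submodule.Quotient.mk_eq_zero _).mp this
  -- A generating tuple reduces to `r` spanning vectors, hence a basis, of `G/pG`. It is recovered
  -- from this basis and its deviations in `pG` from a fixed section.
  let Φ : {f : Fin r → G // AddSubgroup.closure (Set.range f) = ⊤} →
      {s : Fin r → ModN G p // LinearIndependent (ZMod p) s} × (Fin r → (mulHom p G).range) :=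
    fun f => (⟨fun i => ModN.mkQ p (f.1 i), hLI f.1 f.2⟩, fun i => ⟨_, hmem (f.1 i)⟩)
  have hΦ : Function.Injective Φ := by
    intro f f' h
    have h1 : ∀ i, ModN.mkQ p (f.1 i) = ModN.mkQ p (f'.1 i) := fun i =>
      congrFun (congrArg (fun y => y.1.1) h) i
    have h2 : ∀ i, f.1 i - Function.surjInv hπ (ModN.mkQ p (f.1 i))
        = f'.1 i - Function.surjInv hπ (ModN.mkQ p (f'.1 i)) := fun i =>
      congrArg Subtype.val (congrFun (congrArg Prod.snd h) i)
    refine Subtype.ext (funext fun i => ?_)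
    have := h2 i
    rw [h1 i] at this
    exact sub_left_injective this
  have hle := Nat.card_le_card_of_injective Φ hΦ
  rw [Nat.card_prod, card_linearIndependent (by rw [hfin]), Nat.card_fun, Nat.card_fin,
    hfin, ZMod.card] at hle
  have hcard : Nat.card G = Nat.card (mulHom p G).range * p ^ r := by
    rw [← hG, ← index_range_mulHom, AddSubgroup.card_mul_index]
  calc _ ≤ (((∏ i : Fin r, (p ^ r - p ^ i.val)) * Nat.card (mulHom p G).range ^ r : ℕ) : ℝ) := by
        exact_mod_cast hle
    _ = _ := by
      rw [Nat.cast_mul, prod_pow_sub_pow hp.two_le, hcard]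
      push_cast
      ring

end Rank

/-! ### Quotients of `ℤʳ` of `p`-rank `r` -/

section Quotients

variable {p r : ℕ}

/-- The sublattice `pΛ`. -/
def scaleLattice (p : ℕ) (Λ : AddSubgroup (Fin r → ℤ)) : AddSubgroup (Fin r → ℤ) :=
  Λ.map (mulHom p (Fin r → ℤ))

theorem mulHom_injective (hp : p ≠ 0) : Function.Injective (mulHom p (Fin r → ℤ)) := by
  intro v w h
  rw [mulHom_apply, mulHom_apply] at h
  exact smul_right_injective _ hp h

theorem scaleLattice_injective (hp : p ≠ 0) :
    Function.Injective (scaleLattice (r := r) p) :=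
  AddSubgroup.map_injective (mulHom_injective hp)

theorem index_scaleLattice (hp : p ≠ 0) (Λ : AddSubgroup (Fin r → ℤ)) :
    (scaleLattice p Λ).index = Λ.index * p ^ r := by
  have : NeZero p := ⟨hp⟩
  rw [scaleLattice, AddSubgroup.index_map_of_injective _ (mulHom_injective hp),
    index_range_mulHom, ModN.natCard_eq]
  simp

/-- The finite abelian `p`-group `ℤʳ/pΛ`, of `p`-rank `r`. -/
abbrev LatticeQuotient (Λ : PrimaryLattice p r) : Type :=
  Multiplicative ((Fin r → ℤ) ⧸ scaleLattice p Λ.1)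

theorem card_latticeQuotient (hp : p ≠ 0) (Λ : PrimaryLattice p r) :
    Nat.card (LatticeQuotient Λ) = Λ.1.index * p ^ r := by
  rw [← index_scaleLattice hp]; rfl

theorem finite_latticeQuotient (hp : p.Prime) (Λ : PrimaryLattice p r) :
    Finite (LatticeQuotient Λ) := by
  refine Nat.finite_of_card_ne_zero ?_
  rw [card_latticeQuotient hp.ne_zero]
  exact (mul_pos (Λ.index_pos hp.two_le) (pow_pos hp.pos r)).ne'

theorem isPGroup_latticeQuotient (hp : p.Prime) (Λ : PrimaryLattice p r) :
    IsPGroup p (LatticeQuotient Λ) := by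
  obtain ⟨k, hk⟩ := Λ.2
  refine IsPGroup.of_card (n := k + r) ?_
  rw [card_latticeQuotient hp.ne_zero, hk, pow_add]

theorem exists_surjective_of_mulEquiv {H : Type*} [CommGroup H] {Λ : PrimaryLattice p r}
    (e : H ≃* LatticeQuotient Λ) :
    ∃ φ : (Fin r → ℤ) →+ Additive H, Function.Surjective φ ∧ φ.ker = scaleLattice p Λ.1 := by
  let e' : (Fin r → ℤ) ⧸ scaleLattice p Λ.1 ≃+ Additive H :=
    (AddEquiv.additiveMultiplicative _).symm.trans e.symm.toAdditive
  refine ⟨e'.toAddMonoidHom.comp (QuotientAddGroup.mk' _),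
    e'.surjective.comp (QuotientAddGroup.mk'_surjective _), ?_⟩
  ext x
  rw [AddMonoidHom.mem_ker, ← QuotientAddGroup.eq_zero_iff]
  exact e'.map_eq_zero_iff

theorem card_modN_of_mulEquiv (hp : p.Prime) {H : Type*} [CommGroup H] {Λ : PrimaryLattice p r}
    (e : H ≃* LatticeQuotient Λ) : Nat.card (ModN (Additive H) p) = p ^ r := by
  have : NeZero p := ⟨hp.ne_zero⟩
  obtain ⟨φ, hφ, hker⟩ := exists_surjective_of_mulEquiv e
  refine card_modN_of_surjective hφ ?_
  rw [hker]
  exact AddSubgroup.map_le_range _ _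

theorem pRank_latticeQuotient (hp : p.Prime) (Λ : PrimaryLattice p r) :
    pRank p (LatticeQuotient Λ) = r := by
  have := finite_latticeQuotient hp Λ
  refine Nat.pow_right_injective hp.two_le ?_
  simp only [pow_pRank hp]
  exact card_modN_of_mulEquiv hp (MulEquiv.refl _)

theorem addMonoidHom_eq_of_single {G : Type*} [AddCommGroup G] {φ ψ : (Fin r → ℤ) →+ G}
    (h : ∀ i, φ (Pi.single i 1) = ψ (Pi.single i 1)) : φ = ψ :=
  AddMonoidHom.functions_ext' _ _ _ fun i => AddMonoidHom.ext_int (h i)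

theorem closure_range_single {G : Type*} [AddCommGroup G] {φ : (Fin r → ℤ) →+ G}
    (hφ : Function.Surjective φ) :
    AddSubgroup.closure (Set.range fun i => φ (Pi.single i 1)) = ⊤ := by
  rw [eq_top_iff]
  intro g _
  obtain ⟨v, rfl⟩ := hφ g
  rw [← Finset.univ_sum_single v, map_sum]
  refine sum_mem fun i _ => ?_
  have : Pi.single i (v i) = v i • (Pi.single i 1 : Fin r → ℤ) := by
    rw [← Pi.single_smul]; simp
  rw [this, map_zsmul]
  exact zsmul_mem (AddSubgroup.subset_closure (Set.mem_range_self i)) _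

/-- The number of lattices `Λ` with `ℤʳ/pΛ ≅ H` is at most `|H| ^ r (p)_r / |Aut H|`. -/
theorem card_lattices_mul_card_mulAut_le (hp : p.Prime) {H : Type*} [CommGroup H] [Finite H]
    (F : Finset (PrimaryLattice p r)) (hF : ∀ Λ ∈ F, Nonempty (H ≃* LatticeQuotient Λ)) :
    (F.card : ℝ) * Nat.card (MulAut H) ≤ (Nat.card H : ℝ) ^ r * qPoch p r := by
  rcases F.eq_empty_or_nonempty with rfl | ⟨Λ₀, hΛ₀⟩
  · have := (qPoch_pos hp.two_le r).le
    simp only [Finset.card_empty, Nat.cast_zero, zero_mul]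
    positivity
  have hφ := fun Λ : F => exists_surjective_of_mulEquiv (hF Λ.1 Λ.2).some
  choose φ hsurj hker using hφ
  have hG := card_modN_of_mulEquiv hp (hF Λ₀ hΛ₀).some
  refine le_trans ?_ (card_generating_le (G := Additive H) hp hG)
  -- Each lattice contributes one surjection with kernel `pΛ`, twisted by all automorphisms. The
  -- kernel recovers `Λ`, and surjectivity then recovers the automorphism.
  let ψ : F × MulAut H → (Fin r → ℤ) →+ Additive H :=
    fun y => (MonoidHom.toAdditive (MulEquiv.toMonoidHom y.2)).comp (φ y.1)
  have hψ : ∀ y, Function.Surjective (ψ y) := fun y => y.2.surjective.comp (hsurj y.1)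
  have hψker : ∀ y, (ψ y).ker = scaleLattice p y.1.1.1 := by
    intro y
    rw [← hker y.1]
    ext x
    exact EmbeddingLike.map_eq_one_iff (f := y.2)
  let Φ : F × MulAut H → {f : Fin r → Additive H // AddSubgroup.closure (Set.range f) = ⊤} :=
    fun y => ⟨fun i => ψ y (Pi.single i 1), closure_range_single (hψ y)⟩
  have hΦ : Function.Injective Φ := by
    intro y y' h
    have heq : ψ y = ψ y' := addMonoidHom_eq_of_single fun i =>
      congrFun (congrArg Subtype.val h) i
    have h1 : y.1 = y'.1 := by
      refine Subtype.ext (Subtype.ext (scaleLattice_injective hp.ne_zero ?_))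
      rw [← hψker, ← hψker, heq]
    obtain ⟨Λ, α⟩ := y
    obtain ⟨Λ', α'⟩ := y'
    obtain rfl : Λ = Λ' := h1
    refine Prod.ext rfl (MulEquiv.ext fun x => ?_)
    obtain ⟨v, hv⟩ := hsurj Λ (Additive.ofMul x)
    have : α (φ Λ v).toMul = α' (φ Λ v).toMul := DFunLike.congr_fun heq v
    rwa [hv] at this
  have hle := Nat.card_le_card_of_injective Φ hΦ
  rw [Nat.card_prod, Nat.card_eq_fintype_card, Fintype.card_coe] at hle
  exact_mod_cast hle

/-- The weight of a lattice: the inverse of the upper bound for the number of lattices with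
isomorphic quotient. -/
noncomputable def latticeWeight (Λ : PrimaryLattice p r) : ℝ :=
  Nat.card (MulAut (LatticeQuotient Λ)) / ((Nat.card (LatticeQuotient Λ) : ℝ) ^ r * qPoch p r)

open Classical in
-- All contributing lattices have the Sylow subgroup of `A` as quotient, so they share one weight,
-- whose inverse bounds their number. This inequality for a single field is later averaged over
-- fields.
theorem sum_latticeWeight_le (hp : p.Prime) {A : Type*} [CommGroup A] [Finite A]
    (F : Finset (PrimaryLattice p r)) :
    (∑ Λ ∈ F, if ∃ P : Sylow p A, Nonempty (P ≃* LatticeQuotient Λ) then latticeWeight Λ else 0)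
      ≤ if pRank p A = r then 1 else 0 := by
  have : Fact p.Prime := ⟨hp⟩
  let P₀ : Sylow p A := default
  split_ifs with hr
  · rw [← Finset.sum_filter]
    have hmem : ∀ Λ ∈ F.filter (fun Λ => ∃ P : Sylow p A, Nonempty (P ≃* LatticeQuotient Λ)),
        Nonempty (P₀ ≃* LatticeQuotient Λ) := by
      intro Λ hΛ
      obtain ⟨P, ⟨e⟩⟩ := (Finset.mem_filter.mp hΛ).2
      exact ⟨(P₀.equiv P).trans e⟩
    have hpos : (0 : ℝ) < (Nat.card P₀ : ℝ) ^ r * qPoch p r := by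
      have := qPoch_pos hp.two_le r
      have : 0 < Nat.card P₀ := Nat.card_pos
      positivity
    have hw : ∀ Λ ∈ F.filter (fun Λ => ∃ P : Sylow p A, Nonempty (P ≃* LatticeQuotient Λ)),
        latticeWeight Λ = Nat.card (MulAut P₀) / ((Nat.card P₀ : ℝ) ^ r * qPoch p r) := by
      intro Λ hΛ
      obtain ⟨e⟩ := hmem Λ hΛ
      rw [latticeWeight, Nat.card_congr e.toEquiv, Nat.card_congr (MulAut.congr e).toEquiv]
    rw [Finset.sum_congr rfl hw, Finset.sum_const, nsmul_eq_mul, ← mul_div_assoc,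
      div_le_one hpos]
    exact card_lattices_mul_card_mulAut_le hp _ hmem
  · refine (Finset.sum_eq_zero fun Λ _ => if_neg ?_).le
    rintro ⟨P, ⟨e⟩⟩
    exact hr ((pRank_sylow hp P e).trans (pRank_latticeQuotient hp Λ))

end Quotients

/-! ### Densities of fields -/

section Density

variable {K₀ : Type*} [Field K₀] [NumberField K₀]

/-- Hermite's theorem for the extensions of `K₀` inside its algebraic closure. -/
theorem finite_discr_le (S : Situation K₀) (X : ℕ) :
    {K | K ∈ S.fields ∧ |discr K.1| ≤ (X : ℤ)}.Finite := by
  let f : FinExt K₀ → {F : IntermediateField ℚ (AlgebraicClosure K₀) // FiniteDimensional ℚ F} :=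
    fun K => ⟨K.1.restrictScalars ℚ, FiniteDimensional.trans ℚ K₀ K.1⟩
  have hf : Function.Injective f := fun K K' h => Subtype.ext
    (IntermediateField.restrictScalars_injective ℚ (congrArg Subtype.val h))
  refine Set.Finite.subset ((NumberField.finite_of_discr_bdd (AlgebraicClosure K₀) X).preimage
    hf.injOn) ?_
  rintro K ⟨-, hK⟩
  exact hK

/-- The proportion of the fields with property `P` among the fields in `𝓚(Σ)` with absolute
discriminant at most `X`. -/
noncomputable def proportion (S : Situation K₀) (P : FinExt K₀ → Prop) (X : ℕ) : ℝ :=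
  (Set.ncard {K | K ∈ S.fields ∧ |discr K.1| ≤ (X : ℤ) ∧ P K} : ℝ) /
    (Set.ncard {K | K ∈ S.fields ∧ |discr K.1| ≤ (X : ℤ)} : ℝ)

open Classical in
theorem proportion_eq (S : Situation K₀) (P : FinExt K₀ → Prop) (X : ℕ) :
    proportion S P X = (∑ K ∈ (finite_discr_le S X).toFinset, if P K then (1 : ℝ) else 0) /
      (finite_discr_le S X).toFinset.card := by
  rw [proportion, Set.ncard_eq_toFinset_card _ (finite_discr_le S X), Finset.sum_boole]
  congr 2
  rw [← Set.ncard_coe_finset]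
  congr 1
  ext K
  simp [and_assoc]

theorem sum_proportion_le_one (S : Situation K₀) (ρ : FinExt K₀ → ℕ) (s : Finset ℕ) (X : ℕ) :
    ∑ r ∈ s, proportion S (fun K => ρ K = r) X ≤ 1 := by
  classical
  simp only [proportion_eq]
  rw [← Finset.sum_div, Finset.sum_comm]
  refine div_le_one_of_le₀ ?_ (Nat.cast_nonneg _)
  rw [Finset.cast_card]
  refine Finset.sum_le_sum fun K _ => ?_
  have h : (if ρ K ∈ s then (1 : ℝ) else 0) ≤ 1 := by split_ifs <;> norm_num
  refine le_of_eq_of_le ?_ h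
  convert Finset.sum_ite_eq s (ρ K) (fun _ => (1 : ℝ))

open Classical in
theorem sum_mul_proportion_le {ι : Type*} (S : Situation K₀) (F : Finset ι) (w : ι → ℝ)
    (P : ι → FinExt K₀ → Prop) (Q : FinExt K₀ → Prop)
    (h : ∀ K, (∑ i ∈ F, if P i K then w i else 0) ≤ if Q K then 1 else 0) (X : ℕ) :
    ∑ i ∈ F, w i * proportion S (P i) X ≤ proportion S Q X := by
  simp only [proportion_eq, ← mul_div_assoc]
  rw [← Finset.sum_div]
  gcongr
  simp only [Finset.mul_sum, mul_ite, mul_one, mul_zero]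
  rw [Finset.sum_comm]
  exact Finset.sum_le_sum fun K _ => h K

/-- Families of proportions are asymptotic to a probability distribution that asymptotically
bounds them from below. -/
theorem tendsto_of_eventually_lower_bound {f : ℕ → ℕ → ℝ} {δ : ℕ → ℝ} (hδ : HasSum δ 1)
    (hf : ∀ (s : Finset ℕ) X, ∑ r ∈ s, f r X ≤ 1)
    (hlow : ∀ r, ∀ b < δ r, ∀ᶠ X in atTop, b < f r X) (r : ℕ) :
    Tendsto (f r) atTop (𝓝 (δ r)) := by
  classical
  -- Truncation at `δ r` turns the lower bounds into limits, which can be added over a finite set.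
  have hmin : ∀ r, Tendsto (fun X => min (f r X) (δ r)) atTop (𝓝 (δ r)) := fun r =>
    tendsto_order.mpr ⟨fun b hb => (hlow r b hb).mono fun X hX => lt_min hX hb,
      fun b hb => Eventually.of_forall fun X => (min_le_right _ _).trans_lt hb⟩
  refine tendsto_order.mpr ⟨hlow r, fun b hb => ?_⟩
  -- Choose finitely many ranks, including `r`, that carry mass more than `1 - (b - δ r)`. The
  -- others then eventually take up more than `1 - b`, leaving less than `b` for `r`.
  obtain ⟨s, hs, hrs⟩ := ((hδ.eventually (lt_mem_nhds (show 1 - (b - δ r) < 1 by linarith))).and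
    (eventually_ge_atTop {r})).exists
  have hrs : r ∈ s := Finset.singleton_subset_iff.mp hrs
  have hsum := tendsto_finsetSum (s.erase r) fun r' _ => hmin r'
  rw [← Finset.add_sum_erase _ _ hrs] at hs
  filter_upwards [hsum.eventually (lt_mem_nhds (show 1 - b < ∑ r' ∈ s.erase r, δ r' by linarith))]
    with X hX
  have h1 := hf s X
  rw [← Finset.add_sum_erase _ _ hrs] at h1
  have h2 : ∑ r' ∈ s.erase r, min (f r' X) (δ r') ≤ ∑ r' ∈ s.erase r, f r' X :=
    Finset.sum_le_sum fun _ _ => min_le_left _ _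
  linarith

variable {p : ℕ}

theorem rankConst_pos (hp : 2 ≤ p) (u : ℕ) : 0 < rankConst p u := by
  have hp2 : 2 ≤ p ^ 2 := by nlinarith
  have h : ∀ q : ℕ, 2 ≤ q → 0 < qPochInf q := fun q hq =>
    (ge_of_tendsto' (tendsto_qPoch hq) fun k => (qPoch_pos hq k).le).lt_of_ne'
      (qPochInf_ne_zero hq)
  have := h p hp
  have := h _ hp2
  have := qPoch_pos hp u
  have := qPoch_pos hp2 u
  unfold rankConst
  positivity

theorem prod_pow_sub_one (hp : 2 ≤ p) (k : ℕ) :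
    ∏ i ∈ Finset.Icc 1 k, ((p : ℝ) ^ i - 1) = (p : ℝ) ^ ((k + 1).choose 2) * qPoch p k := by
  have hp' : (0 : ℝ) < p := by positivity
  induction k with
  | zero => simp [qPoch_zero]
  | succ k ih =>
    have e : (k + 1 + 1).choose 2 = (k + 1) + (k + 1).choose 2 := by
      rw [Nat.choose_succ_succ' (k + 1) 1, Nat.choose_one_right]
    rw [Finset.prod_Icc_succ_top (by omega), ih, qPoch_succ, e, pow_add _ (k + 1)]
    have : (p : ℝ) ^ (k + 1) - 1 = (p : ℝ) ^ (k + 1) * (1 - ((p : ℝ) ^ (k + 1))⁻¹) := by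
      field_simp
    rw [this]
    ring

/-- This balances the powers of `p` from the weights, from Euler's term and from `|ℤʳ/pΛ| = [ℤʳ : Λ]
p ^ r`. -/
theorem choose_two_add (r u : ℕ) :
    (r + u + 1).choose 2 + r.choose 2 = (u + 1).choose 2 + r * (r + u) := by
  have h : (((r + u + 1).choose 2 + r.choose 2 : ℕ) : ℚ)
      = ((u + 1).choose 2 + r * (r + u) : ℕ) := by
    push_cast [Nat.cast_choose_two]
    ring
  exact_mod_cast h

theorem latticeWeight_mul_density (hp : p.Prime) (u : ℕ) {r : ℕ} (Λ : PrimaryLattice p r) :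
    latticeWeight Λ * (sylowConst p u * sylowWeight p u (LatticeQuotient Λ))
      = rankConst p u * eulerTerm p ((p : ℝ) ^ (u + 1))⁻¹ r / (qPoch p u / qPoch p (u + r))
        * ((Λ.1.index : ℝ) ^ (u + r))⁻¹ := by
  have := finite_latticeQuotient hp Λ
  have hfin : Finite (MulAut (LatticeQuotient Λ)) := DFunLike.finite _
  have hA : (Nat.card (MulAut (LatticeQuotient Λ)) : ℝ) ≠ 0 :=
    Nat.cast_ne_zero.mpr Nat.card_pos.ne'
  have hp' : (0 : ℝ) < p := by exact_mod_cast hp.pos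
  have hI : (0 : ℝ) < Λ.1.index := by exact_mod_cast Λ.index_pos hp.two_le
  have h1 := (qPoch_pos hp.two_le r).ne'
  have h2 := (qPoch_pos hp.two_le u).ne'
  have h3 := (qPoch_pos hp.two_le (u + r)).ne'
  rw [latticeWeight, sylowConst, sylowWeight, pRank_latticeQuotient hp, eulerTerm,
    prod_pow_sub_one hp.two_le, prod_pow_sub_one hp.two_le, card_latticeQuotient hp.ne_zero]
  generalize (Nat.card (MulAut (LatticeQuotient Λ)) : ℝ) = a at hA
  have hc : (p : ℝ) ^ ((r + u + 1).choose 2) * (p : ℝ) ^ (r.choose 2)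
      = (p : ℝ) ^ ((u + 1).choose 2) * ((p : ℝ) ^ r) ^ (r + u) := by
    rw [← pow_add, choose_two_add, pow_add, pow_mul]
  rw [add_comm u r] at h3 ⊢
  have e1 : (p : ℝ) ^ ((r + u + 1).choose 2)
      = (p : ℝ) ^ ((u + 1).choose 2) * ((p : ℝ) ^ r) ^ (r + u) / (p : ℝ) ^ (r.choose 2) := by
    rw [← hc]; field_simp
  rw [e1, mul_comm r (u + 1), pow_mul, inv_pow]
  push_cast
  rw [mul_pow, mul_pow, pow_add _ r u, pow_add _ r u]
  have hy : (p : ℝ) ^ (u + 1).choose 2 ≠ 0 := by positivity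
  generalize ((p : ℝ) ^ (u + 1)) ^ r = x, (p : ℝ) ^ (u + 1).choose 2 = y,
    (p : ℝ) ^ r.choose 2 = z at hy ⊢
  field_simp

theorem eventually_lt_proportion_rank (hp : p.Prime) (S : Situation K₀) {u : ℕ}
    (hdist : SylowDistribution S p u) (r : ℕ) {b : ℝ}
    (hb : b < rankConst p u * eulerTerm p ((p : ℝ) ^ (u + 1))⁻¹ r) :
    ∀ᶠ X in atTop, b < proportion S (fun K => pRank p (relClassGroup K₀ K.1) = r) X := by
  have hp' : (0 : ℝ) < p := by exact_mod_cast hp.pos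
  have hδ : 0 < rankConst p u * eulerTerm p ((p : ℝ) ^ (u + 1))⁻¹ r :=
    mul_pos (rankConst_pos hp.two_le u) (eulerTerm_pos hp.two_le (by positivity) r)
  have hQ : 0 < qPoch p u / qPoch p (u + r) :=
    div_pos (qPoch_pos hp.two_le _) (qPoch_pos hp.two_le _)
  have hD := div_pos hδ hQ
  -- The bound is `b` divided by the constant of `latticeWeight_mul_density`, so that the weighted
  -- predicted masses over `F` add up to more than `b`.
  obtain ⟨F, hF⟩ := exists_finset_primaryLattice hp.two_le u r
    (B := b / (rankConst p u * eulerTerm p ((p : ℝ) ^ (u + 1))⁻¹ r /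
      (qPoch p u / qPoch p (u + r)))) (by
    rw [div_lt_iff₀ hD, mul_div_cancel₀ _ hQ.ne']
    exact hb)
  rw [div_lt_iff₀' hD, Finset.mul_sum] at hF
  simp only [← latticeWeight_mul_density hp] at hF
  have hlim : Tendsto (fun X => ∑ Λ ∈ F, latticeWeight Λ * proportion S
      (fun K => ∃ P : Sylow p (relClassGroup K₀ K.1), Nonempty (P ≃* LatticeQuotient Λ)) X) atTop
      (𝓝 (∑ Λ ∈ F, latticeWeight Λ * (sylowConst p u * sylowWeight p u (LatticeQuotient Λ)))) := by
    refine tendsto_finsetSum _ fun Λ _ => Tendsto.const_mul _ ?_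
    have := finite_latticeQuotient hp Λ
    exact hdist (LatticeQuotient Λ) (isPGroup_latticeQuotient hp Λ)
  filter_upwards [hlim.eventually (lt_mem_nhds hF)] with X hX
  refine hX.trans_le (sum_mul_proportion_le S F _ _ _ (fun K => ?_) X)
  have : Finite (ClassGroup (𝓞 K.1)) := Finite.of_fintype _
  have : Finite (relClassGroup K₀ K.1) := Subtype.finite
  convert sum_latticeWeight_le (A := relClassGroup K₀ K.1) hp F

theorem hasRankProbability_of_sylowDistribution (hp : p.Prime) (S : Situation K₀) {u : ℕ}
    (hdist : SylowDistribution S p u) (r : ℕ) :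
    HasRankProbability S p r
      (rankConst p u * (1 / ((p : ℝ) ^ (((r : ℝ) * (r + 2 * u + 1)) / 2) * qPoch p r))) := by
  -- The zeroth moment says that the predicted rank probabilities have total mass 1.
  have hsum := hasSum_moment hp.two_le u 0
  simp only [pow_zero, one_mul, Finset.Icc_eq_empty_of_lt zero_lt_one, Finset.prod_empty] at hsum
  refine tendsto_of_eventually_lower_bound hsum
    (f := fun r => proportion S (fun K => pRank p (relClassGroup K₀ K.1) = r))
    (fun s X => sum_proportion_le_one S _ s X) (fun r b hb => ?_) r
  rw [rankDensity_eq_eulerTerm hp.two_le] at hb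
  exact eventually_lt_proportion_rank hp S hdist r hb

end Density

theorem mainTheorem1 {K₀ : Type*} [Field K₀] [NumberField K₀] (S : Situation K₀)
    (p : ℕ) (hp : p.Prime)
    (K₁ : FinExt K₀) (hK₁ : K₁ ∈ S.fields) (u : ℕ) (hu : IsUnitMultiplicity K₁ u)
    (hdist : SylowDistribution S p u) :
    (∀ r : ℕ, HasRankProbability S p r
      (rankConst p u * (1 / ((p : ℝ) ^ (((r : ℝ) * (r + 2 * u + 1)) / 2) * qPoch p r)))) ∧
    (∀ n : ℕ, HasHigherMoment S p n
      (∏ k ∈ Finset.Icc 1 n, (1 + (p : ℝ) ^ ((k : ℤ) - (u : ℤ) - 1)))) :=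
  ⟨hasRankProbability_of_sylowDistribution hp S hdist, fun n =>
    ⟨_, hasRankProbability_of_sylowDistribution hp S hdist, hasSum_moment hp.two_le u n⟩⟩
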